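/- Let $n,m,L,T,N_v$ be finite. Write $[I;Z^T]$ for vertical concatenation. For a symmetric $\Phi=\begin{bmatrix}\Phi_{11}&\Phi_{12}\\ \Phi_{12}^T&\Phi_{22}\end{bmatrix}$ with $\Phi_{11}\in\mathbb R^{n\times n}$ and $\Phi_{22}\in\mathbb R^{k\times k}$, let $\mathrm{QBP}(\Phi)$ (resp. $\mathrm{SQBP}(\Phi)$) be the set of $Z\in\mathbb R^{n\times k}$ such that $[I_n;Z^T]^T\,\Phi\,[I_n;Z^T]$ is positive semidefinite (resp. positive definite). Let data $\mathbf X_-\in\mathbb R^{n\times T}$, $\mathbf U\in\mathbb R^{m\times T}$, $\mathbf\Theta\in\mathbb R^{L\times T}$, $\mathbf X_\delta\in\mathbb R^{n\times T}$ be given, with columns $x(t),u(t),\theta(t),\delta x(t)$, where $\delta x=\dot x$. A plant is a tuple $(\{A_\ell\}_{\ell=1}^L,B)$ with $A_\ell\in\mathbb R^{n\times n}$, $B\in\mathbb R^{n\times m}$; its discrepancy matrix $\mathbf W$ has the columns $$w(t)=\delta x(t)-\Big(\sum_{\ell=1}^L\theta_\ell(t)A_\ell\Big)x(t)-Bu(t).$$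 Let $\Phi\in\mathbb R^{(n+T)\times(n+T)}$ be symmetric with $-\Phi_{22}\succeq 0$ and $\ker\Phi_{22}\subseteq\ker\Phi_{12}$. Let $\Sigma_{\mathcal D}(\Phi)$ be the set of plants with $\mathbf W\in\mathrm{QBP}(\Phi)$, and assume that it contains the ground-truth plant (so it is non-empty). Put $$G=\begin{bmatrix}I_n&\mathbf X_\delta\\0&-\mathbf\Theta\otimes_{\rm col}\mathbf X_-\\0&-\mathbf U\end{bmatrix},\qquad \Psi=G\,\Phi\,G^T,$$ where column $t$ of $\mathbf\Theta\otimes_{\rm col}\mathbf X_-$ is the stacked vector $[\theta_1(t)x(t);\dots;\theta_L(t)x(t)]$. Let $\omega_1,\dots,\omega_{N_v}\in\mathbb R^L$ be the vertices of the parameter polytope, let $Y\in\mathbb R^{n\times n}$ be symmetric positive definite, and let $K_v\in\mathbb R^{m\times n}$ be a gain for each $v$. For $\beta\in\mathbb R$ put $$M_v(\beta)=\begin{bmatrix}-\beta I_n&\ast&\ast\\-\omega_v\otimes Y^{-1}&0&\ast\\-K_vY^{-1}&0&0\end{bmatrix}$$ (symmetric, $\ast$ denoting transposed blocks). Then, for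 each $v$, the strict quadratic matrix inequality $$[A_1,\dots,A_L,B]\in\mathrm{SQBP}(M_v(0))$$ holds for every plant $(\{A_\ell\},B)\in\Sigma_{\mathcal D}(\Phi)$ if and only if there exist $\alpha_v\ge 0$ and $\beta_v>0$ such that $$M_v(\beta_v)-\alpha_v\Psi\succeq 0 .$$ -/

import Mathlib

open scoped Matrix

noncomputable section

/-- The matrix `[I; Zᵀ]ᵀ Φ [I; Zᵀ]` for a symmetric block matrix `Φ` partitioned along `ι ⊕ κ`. -/
def qmiValue {ι κ : Type*} [Fintype ι] [Fintype κ] [DecidableEq ι]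
    (Φ : Matrix (ι ⊕ κ) (ι ⊕ κ) ℝ) (Z : Matrix ι κ ℝ) : Matrix ι ι ℝ :=
  (Matrix.fromRows (1 : Matrix ι ι ℝ) Zᵀ)ᵀ * Φ * Matrix.fromRows (1 : Matrix ι ι ℝ) Zᵀ

/-- `QBP(Φ)`: the matrices with the quadratic boundedness property with respect to `Φ`. -/
def QBP {ι κ : Type*} [Fintype ι] [Fintype κ] [DecidableEq ι]
    (Φ : Matrix (ι ⊕ κ) (ι ⊕ κ) ℝ) : Set (Matrix ι κ ℝ) :=
  {Z | (qmiValue Φ Z).PosSemidef}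

/-- `SQBP(Φ)`: the strict quadratic boundedness property. -/
def SQBP {ι κ : Type*} [Fintype ι] [Fintype κ] [DecidableEq ι]
    (Φ : Matrix (ι ⊕ κ) (ι ⊕ κ) ℝ) : Set (Matrix ι κ ℝ) :=
  {Z | (qmiValue Φ Z).PosDef}

/-- The column-wise Khatri-Rao product: column `t` is the Kronecker product of the columns `t`
of the two factors. Rows are indexed by pairs. -/
def khatriRao {ι κ τ : Type*} (A : Matrix ι τ ℝ) (B : Matrix κ τ ℝ) : Matrix (ι × κ) τ ℝ :=
  Matrix.of fun p t => A p.1 t * B p.2 t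

/-- The matrix `ω ⊗ Q` of a column vector `ω` and a matrix `Q`, that is, the blocks `ω_ℓ Q`
stacked vertically. -/
def vecKron {ι κ τ : Type*} (ω : ι → ℝ) (Q : Matrix κ τ ℝ) : Matrix (ι × κ) τ ℝ :=
  Matrix.of fun p j => ω p.1 * Q p.2 j

/-- A record of `T` samples of the state, the input, the parameter, and the derivative
(or successor) of the state. Column `t` holds sample `t`. -/
structure LPVData (n m L T : ℕ) where
  X : Matrix (Fin n) (Fin T) ℝ
  U : Matrix (Fin m) (Fin T) ℝ
  Θ : Matrix (Fin L) (Fin T) ℝ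
  Xδ : Matrix (Fin n) (Fin T) ℝ

/-- A plant `δx = (∑ ℓ, θ_ℓ A_ℓ) x + B u`. -/
structure LPVAPlant (n m L : ℕ) where
  A : Fin L → Matrix (Fin n) (Fin n) ℝ
  B : Matrix (Fin n) (Fin m) ℝ

/-- The horizontal concatenation `[A_1, …, A_L, B]`. -/
def LPVAPlant.toMatrix {n m L : ℕ} (S : LPVAPlant n m L) :
    Matrix (Fin n) ((Fin L × Fin n) ⊕ Fin m) ℝ :=
  Matrix.fromCols (Matrix.of fun i p => S.A p.1 i p.2) S.B

/-- The open-loop matrix `∑ ℓ, θ_ℓ A_ℓ` at the parameter value `θ`. -/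
def LPVAPlant.Aat {n m L : ℕ} (S : LPVAPlant n m L) (θ : Fin L → ℝ) :
    Matrix (Fin n) (Fin n) ℝ :=
  ∑ ℓ, θ ℓ • S.A ℓ

/-- The discrepancy matrix, with columns
`w(t) = δx(t) - (∑ ℓ, θ_ℓ(t) A_ℓ) x(t) - B u(t)`. -/
def LPVData.discrepancy {n m L T : ℕ} (D : LPVData n m L T) (S : LPVAPlant n m L) :
    Matrix (Fin n) (Fin T) ℝ :=
  Matrix.of fun i t =>
    D.Xδ i t - (S.Aat (fun ℓ => D.Θ ℓ t) *ᵥ fun j => D.X j t) i - (S.B *ᵥ fun k => D.U k t) i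

/-- The set of plants that are consistent with the data under the noise model `Φ`. -/
def consistentPlants {n m L T : ℕ} (D : LPVData n m L T)
    (Φ : Matrix (Fin n ⊕ Fin T) (Fin n ⊕ Fin T) ℝ) : Set (LPVAPlant n m L) :=
  {S | D.discrepancy S ∈ QBP Φ}

/-- The factor `[I, Xδ; 0, -Θ ⊗_col X; 0, -U]`. -/
def LPVData.factor {n m L T : ℕ} (D : LPVData n m L T) :
    Matrix (Fin n ⊕ ((Fin L × Fin n) ⊕ Fin m)) (Fin n ⊕ Fin T) ℝ :=
  Matrix.fromBlocks 1 D.Xδ 0 (Matrix.fromRows (-khatriRao D.Θ D.X) (-D.U))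

/-- The data matrix `Ψ`. -/
def LPVData.Psi {n m L T : ℕ} (D : LPVData n m L T)
    (Φ : Matrix (Fin n ⊕ Fin T) (Fin n ⊕ Fin T) ℝ) :
    Matrix (Fin n ⊕ ((Fin L × Fin n) ⊕ Fin m)) (Fin n ⊕ ((Fin L × Fin n) ⊕ Fin m)) ℝ :=
  D.factor * Φ * D.factorᵀ

/-- The symmetric block matrix with rows `(-β I, *, *)`, `(-ω ⊗ Y⁻¹, 0, *)`, `(-K Y⁻¹, 0, 0)`.
For `β = 0` it is the matrix of the strict QMI `-2 sym ((A_v + B K) Y⁻¹) ≻ 0` in `[A_1, …, A_L, B]`. -/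
def vertexMatrix {n m L : ℕ} (Y : Matrix (Fin n) (Fin n) ℝ) (ω : Fin L → ℝ)
    (K : Matrix (Fin m) (Fin n) ℝ) (β : ℝ) :
    Matrix (Fin n ⊕ ((Fin L × Fin n) ⊕ Fin m)) (Fin n ⊕ ((Fin L × Fin n) ⊕ Fin m)) ℝ :=
  Matrix.fromBlocks (-(β • (1 : Matrix (Fin n) (Fin n) ℝ)))
    (Matrix.fromRows (-vecKron ω Y⁻¹) (-(K * Y⁻¹)))ᵀ
    (Matrix.fromRows (-vecKron ω Y⁻¹) (-(K * Y⁻¹)))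
    0

end

/-! Since `[I; Zᵀ]ᵀ G = [I; Wᵀ]ᵀ`, consistency of a plant is the QMI of `Ψ` in its coefficient
matrix `Z`, and every `Z` comes from a plant. The claim is thus a strict matrix S-lemma,
`QBP_subset_SQBP_iff`, whose conclusion is affine in `Z` because the lower right block of `M_v` is
zero.

Write `-P` for `Ψ₂₂`. The kernel condition allows completing the square: with `Δ` the deviation from
a centre, the hypothesis reads `Q - Δ P Δᵀ ⪰ 0`, and nonemptiness gives only `Q ⪰ 0`, not a Slater
point. Rank-one choices of `Δ` turn the robust inequality into an implication between quadratic
forms in `x` and `e = Δᵀ x`. They also force the linear term `F` to vanish on `ker P`, so `F = H P`.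
Compactness of the unit sphere then leaves room to relax `Q` to `Q + ε I` and tighten the conclusion
by `ε I`. The relaxed form takes a positive value, so the scalar S-lemma
`exists_nonneg_mul_le_of_pos` yields `α`, and `ε` serves as `β`. -/

namespace Matrix

/-! ### The scalar S-lemma and auxiliary linear algebra. -/

variable {ι κ τ : Type*} [Fintype ι] [Fintype κ] [Fintype τ]

lemma dotProduct_mulVec_add_smul (M : Matrix ι ι ℝ) (a b : ι → ℝ) (t : ℝ) :
    (a + t • b) ⬝ᵥ M *ᵥ (a + t • b) =
      a ⬝ᵥ M *ᵥ a + t * (a ⬝ᵥ M *ᵥ b + b ⬝ᵥ M *ᵥ a) + t ^ 2 * (b ⬝ᵥ M *ᵥ b) := by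
  simp only [mulVec_add, mulVec_smul, dotProduct_add, add_dotProduct, smul_dotProduct,
    dotProduct_smul, smul_eq_mul]
  ring

lemma dotProduct_mulVec_smul_self (M : Matrix ι ι ℝ) (a : ι → ℝ) (t : ℝ) :
    (t • a) ⬝ᵥ M *ᵥ (t • a) = t ^ 2 * (a ⬝ᵥ M *ᵥ a) := by
  simpa using dotProduct_mulVec_add_smul M 0 a t

/-- A homogeneous S-lemma: if `N` takes a positive value, and `M` is positive wherever `N` is
nonnegative except along directions in the radical of `N`, then `M - α N` is nonnegative for some
`α ≥ 0`. -/
theorem exists_nonneg_mul_le_of_pos {M N : Matrix ι ι ℝ}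
    (h : ∀ z, 0 ≤ z ⬝ᵥ N *ᵥ z → 0 < z ⬝ᵥ M *ᵥ z ∨
      (z ⬝ᵥ M *ᵥ z = 0 ∧ ∀ w, (w + z) ⬝ᵥ N *ᵥ (w + z) = w ⬝ᵥ N *ᵥ w))
    (hN : ∃ a, 0 < a ⬝ᵥ N *ᵥ a) :
    ∃ α : ℝ, 0 ≤ α ∧ ∀ z, α * (z ⬝ᵥ N *ᵥ z) ≤ z ⬝ᵥ M *ᵥ z := by
  have hnn : ∀ z, 0 ≤ z ⬝ᵥ N *ᵥ z → 0 ≤ z ⬝ᵥ M *ᵥ z := fun z hz =>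
    (h z hz).elim le_of_lt fun h => h.1.ge
  have key : ∀ a b, 0 < a ⬝ᵥ N *ᵥ a → b ⬝ᵥ N *ᵥ b < 0 →
      b ⬝ᵥ M *ᵥ b / (b ⬝ᵥ N *ᵥ b) ≤ a ⬝ᵥ M *ᵥ a / (a ⬝ᵥ N *ᵥ a) := by
    intro a b ha hb
    have hM := dotProduct_mulVec_add_smul M a b
    have hN := dotProduct_mulVec_add_smul N a b
    have hroot : ∀ t : ℝ, (a + t • b) ⬝ᵥ N *ᵥ (a + t • b) = 0 →
        0 < (a + t • b) ⬝ᵥ M *ᵥ (a + t • b) := by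
      intro t ht
      -- If `a + t b` were in the radical of `N`, shifting `-t b` by it would give `N(a) = t² N(b)`,
      -- against the signs.
      refine (h _ ht.ge).resolve_right fun h' => ?_
      have := h'.2 (-(t • b))
      rw [neg_add_cancel_comm_assoc, ← neg_smul, dotProduct_mulVec_smul_self] at this
      nlinarith [sq_nonneg t]
    generalize a ⬝ᵥ N *ᵥ b + b ⬝ᵥ N *ᵥ a = p at *
    generalize a ⬝ᵥ M *ᵥ b + b ⬝ᵥ M *ᵥ a = r at *
    simp only [hM, hN] at hroot
    generalize a ⬝ᵥ N *ᵥ a = ga at *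
    generalize a ⬝ᵥ M *ᵥ a = fa at *
    generalize b ⬝ᵥ N *ᵥ b = gb at *
    generalize b ⬝ᵥ M *ᵥ b = fb at *
    -- The line `a + t b` meets the null cone of `N` at two parameters of opposite sign.
    have hs : 0 < p ^ 2 - 4 * ga * gb := by nlinarith [mul_pos ha (neg_pos.2 hb), sq_nonneg p]
    obtain ⟨s, hs0, hss⟩ : ∃ s, 0 < s ∧ s ^ 2 = p ^ 2 - 4 * ga * gb :=
      ⟨_, Real.sqrt_pos.2 hs, Real.sq_sqrt hs.le⟩
    have hgb : gb ≠ 0 := hb.ne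
    have hps : |p| < s := abs_lt_of_sq_lt_sq (by nlinarith [mul_pos ha (neg_pos.2 hb)]) hs0.le
    obtain ⟨hps1, hps2⟩ := abs_lt.1 hps
    have e1 : ga + (-p + s) / (2 * gb) * p + ((-p + s) / (2 * gb)) ^ 2 * gb = 0 := by
      field_simp; linear_combination hss
    have e2 : ga + (-p - s) / (2 * gb) * p + ((-p - s) / (2 * gb)) ^ 2 * gb = 0 := by
      field_simp; linear_combination hss
    have r1 := hroot _ e1
    have r2 := hroot _ e2
    have ht1 : (-p + s) / (2 * gb) < 0 := div_neg_of_pos_of_neg (by linarith) (by linarith)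
    have ht2 : 0 < (-p - s) / (2 * gb) := div_pos_of_neg_of_neg (by linarith) (by linarith)
    generalize (-p + s) / (2 * gb) = t₁ at *
    generalize (-p - s) / (2 * gb) = t₂ at *
    -- Subtracting `l` times the `N`-quadratic cancels the constant term. After division by `t`, an
    -- affine function remains that is negative at `t₁ < 0` and positive at `t₂ > 0`, so its slope
    -- `fb - l gb` is positive.
    set l := fa / ga with hl
    have hfa : fa = l * ga := by rw [hl]; field_simp
    have c1 : 0 < t₁ * ((r - l * p) + t₁ * (fb - l * gb)) := by
      have : t₁ * ((r - l * p) + t₁ * (fb - l * gb)) =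
        fa + t₁ * r + t₁ ^ 2 * fb := by linear_combination - hfa - l * e1
      linarith
    have c2 : 0 < t₂ * ((r - l * p) + t₂ * (fb - l * gb)) := by
      have : t₂ * ((r - l * p) + t₂ * (fb - l * gb)) =
        fa + t₂ * r + t₂ ^ 2 * fb := by linear_combination - hfa - l * e2
      linarith
    have d1 := neg_of_mul_pos_right c1 ht1.le
    have d2 := pos_of_mul_pos_right c2 ht2.le
    have : 0 < fb - l * gb := by
      by_contra! hneg
      nlinarith [mul_nonneg (sub_nonneg.2 (ht1.trans ht2).le) (neg_nonneg.2 hneg)]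
    rw [div_le_iff_of_neg hb]
    linarith
  obtain ⟨a, ha⟩ := hN
  -- The multiplier is the supremum of these lower bounds; inserting `0` makes it nonnegative and
  -- the set nonempty.
  let S : Set ℝ := insert 0 {l | ∃ b, b ⬝ᵥ N *ᵥ b < 0 ∧ l = b ⬝ᵥ M *ᵥ b / (b ⬝ᵥ N *ᵥ b)}
  have hub : ∀ a, 0 < a ⬝ᵥ N *ᵥ a → ∀ l ∈ S, l ≤ a ⬝ᵥ M *ᵥ a / (a ⬝ᵥ N *ᵥ a) := by
    rintro a ha l (rfl | ⟨b, hb, rfl⟩)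
    · exact div_nonneg (hnn a ha.le) ha.le
    · exact key a b ha hb
  have hbdd : BddAbove S := ⟨_, hub a ha⟩
  refine ⟨sSup S, le_csSup hbdd (Set.mem_insert _ _), fun z => ?_⟩
  rcases lt_trichotomy (z ⬝ᵥ N *ᵥ z) 0 with hz | hz | hz
  · rw [← div_le_iff_of_neg hz]
    exact le_csSup hbdd (Set.mem_insert_of_mem _ ⟨z, hz, rfl⟩)
  · rw [hz, mul_zero]
    exact hnn z hz.ge
  · rw [← le_div_iff₀ hz]
    exact csSup_le ⟨0, Set.mem_insert _ _⟩ (hub z hz)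

/-- A matrix factors on the right through any matrix with a smaller kernel. -/
lemma exists_eq_mul_of_ker_le {ρ : Type*} (P : Matrix τ κ ℝ) (F : Matrix ρ κ ℝ)
    (h : ∀ v, P *ᵥ v = 0 → F *ᵥ v = 0) : ∃ H : Matrix ρ τ ℝ, F = H * P := by
  classical
  -- `g` extends the inverse of `P` modulo its kernel from the range to the whole space.
  obtain ⟨g, hg⟩ := P.mulVecLin.quotKerEquivRange.symm.toLinearMap.exists_extend
  let l := (LinearMap.ker P.mulVecLin).liftQ F.mulVecLin (fun v hv => h v hv) ∘ₗ g
  have hl : ∀ v, l (P *ᵥ v) = F *ᵥ v := by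
    intro v
    have h1 := LinearMap.congr_fun hg ⟨P.mulVecLin v, LinearMap.mem_range_self _ v⟩
    have h2 : P.mulVecLin.quotKerEquivRange.symm ⟨P.mulVecLin v, LinearMap.mem_range_self _ v⟩ =
        Submodule.Quotient.mk v := by
      rw [LinearEquiv.symm_apply_eq]; rfl
    change (LinearMap.ker P.mulVecLin).liftQ F.mulVecLin (fun v hv => h v hv) (g (P.mulVecLin v)) = _
    rw [show g (P.mulVecLin v) = Submodule.Quotient.mk v from h1.trans h2]
    rfl
  refine ⟨LinearMap.toMatrix' l, mulVec_injective (funext fun v => ?_)⟩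
  rw [← mulVec_mulVec, LinearMap.toMatrix'_mulVec, hl]

/-- Cauchy–Schwarz: the quadratic in `t` given by the form at `x + t y` is nonnegative, so its
discriminant is at most zero. -/
lemma PosSemidef.sq_dotProduct_mulVec_le {M : Matrix ι ι ℝ} (hM : M.PosSemidef) (x y : ι → ℝ) :
    (x ⬝ᵥ M *ᵥ y) ^ 2 ≤ (x ⬝ᵥ M *ᵥ x) * (y ⬝ᵥ M *ᵥ y) := by
  have hsymm : y ⬝ᵥ M *ᵥ x = x ⬝ᵥ M *ᵥ y := by
    rw [dotProduct_comm, ← vecMul_transpose, ← dotProduct_mulVec]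
    congr 2
    simpa using hM.1.eq
  have := discrim_le_zero (a := y ⬝ᵥ M *ᵥ y) (b := 2 * (x ⬝ᵥ M *ᵥ y)) (c := x ⬝ᵥ M *ᵥ x)
    fun t => by
      have h1 := hM.dotProduct_mulVec_nonneg (x + t • y)
      rw [star_trivial, dotProduct_mulVec_add_smul, hsymm] at h1
      linarith
  rw [discrim] at this
  linarith

end Matrix

/-! ### Quadratic forms of symmetric matrices. -/

namespace Matrix

variable {ι κ : Type*} [Fintype ι] [Fintype κ]

lemma IsSymm.dotProduct_mulVec_comm {M : Matrix ι ι ℝ} (hM : M.IsSymm) (x y : ι → ℝ) :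
    x ⬝ᵥ M *ᵥ y = y ⬝ᵥ M *ᵥ x := by
  rw [dotProduct_comm, ← vecMul_transpose, ← dotProduct_mulVec, hM.eq]

lemma IsSymm.posSemidef_iff {M : Matrix ι ι ℝ} (hM : M.IsSymm) :
    M.PosSemidef ↔ ∀ x, 0 ≤ x ⬝ᵥ M *ᵥ x := by
  rw [posSemidef_iff_dotProduct_mulVec, isHermitian_iff_isSymm]
  simp [hM]

lemma dotProduct_mul_mul_transpose_mulVec (Δ : Matrix ι κ ℝ) (P : Matrix κ κ ℝ) (x : ι → ℝ) :
    x ⬝ᵥ (Δ * P * Δᵀ) *ᵥ x = (Δᵀ *ᵥ x) ⬝ᵥ P *ᵥ (Δᵀ *ᵥ x) := by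
  rw [← mulVec_mulVec, ← mulVec_mulVec, dotProduct_mulVec, ← mulVec_transpose]

lemma dotProduct_add_mul_transpose_mulVec (E : Matrix ι ι ℝ) (F Δ : Matrix ι κ ℝ) (x : ι → ℝ) :
    x ⬝ᵥ (E + F * Δᵀ + Δ * Fᵀ) *ᵥ x = x ⬝ᵥ E *ᵥ x + 2 * (x ⬝ᵥ F *ᵥ (Δᵀ *ᵥ x)) := by
  have : x ⬝ᵥ (Δ * Fᵀ) *ᵥ x = x ⬝ᵥ (F * Δᵀ) *ᵥ x := by
    rw [dotProduct_comm, ← vecMul_transpose, ← dotProduct_mulVec]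
    simp
  rw [add_mulVec, add_mulVec, dotProduct_add, dotProduct_add, this, ← mulVec_mulVec]
  ring

/-! ### Robust linear matrix inequalities over `Q - Δ P Δᵀ ⪰ 0`. -/

section Robust

variable {E Q : Matrix ι ι ℝ} {F : Matrix ι κ ℝ} {P : Matrix κ κ ℝ}

/-- Boundedness below on an unbounded direction forces the linear term to vanish there. -/
lemma mulVec_eq_zero_of_robust (hQ : Q.PosSemidef)
    (h : ∀ Δ : Matrix ι κ ℝ, (Q - Δ * P * Δᵀ).PosSemidef →
      ∀ x, x ≠ 0 → 0 < x ⬝ᵥ (E + F * Δᵀ + Δ * Fᵀ) *ᵥ x)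
    {v : κ → ℝ} (hv : P *ᵥ v = 0) : F *ᵥ v = 0 := by
  by_contra hu
  set u := F *ᵥ v with hudef
  have huu : 0 < u ⬝ᵥ u := by
    simpa using dotProduct_star_self_pos_iff.2 hu
  -- `Δ = t u vᵀ` is admissible for every `t` because `P v = 0`, yet the inequality at `u` is affine
  -- in `t` with nonzero slope.
  have key : ∀ t : ℝ, 0 < u ⬝ᵥ E *ᵥ u + 2 * (t * (u ⬝ᵥ u) ^ 2) := by
    intro t
    have h0 : t • vecMulVec u v * P * (t • vecMulVec u v)ᵀ = 0 := by
      rw [transpose_smul, transpose_vecMulVec, Matrix.mul_assoc, Matrix.mul_smul, mul_vecMulVec, hv]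
      simp
    have := h (t • vecMulVec u v) (by rw [h0, sub_zero]; exact hQ) u hu
    rw [dotProduct_add_mul_transpose_mulVec] at this
    have e : (t • vecMulVec u v)ᵀ *ᵥ u = (t * (u ⬝ᵥ u)) • v := by
      rw [transpose_smul, transpose_vecMulVec, smul_mulVec, vecMulVec_mulVec, op_smul_eq_smul,
        smul_smul]
    rw [e, mulVec_smul, ← hudef, dotProduct_smul, smul_eq_mul] at this
    linarith
  have := key (-(u ⬝ᵥ E *ᵥ u) / (2 * (u ⬝ᵥ u) ^ 2))
  have h2 : 2 * (-(u ⬝ᵥ E *ᵥ u) / (2 * (u ⬝ᵥ u) ^ 2) * (u ⬝ᵥ u) ^ 2) = -(u ⬝ᵥ E *ᵥ u) := by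
    field_simp
  linarith

/-- Passage from matrices `Δ` to vectors `e = Δᵀ x`. -/
lemma pos_of_robust (hQ : Q.PosSemidef) (hP : P.PosSemidef)
    (h : ∀ Δ : Matrix ι κ ℝ, (Q - Δ * P * Δᵀ).PosSemidef →
      ∀ x, x ≠ 0 → 0 < x ⬝ᵥ (E + F * Δᵀ + Δ * Fᵀ) *ᵥ x)
    {x : ι → ℝ} (hx : x ≠ 0) {e : κ → ℝ} (he : e ⬝ᵥ P *ᵥ e ≤ x ⬝ᵥ Q *ᵥ x) :
    0 < x ⬝ᵥ E *ᵥ x + 2 * (x ⬝ᵥ F *ᵥ e) := by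
  have hQs : Q.IsSymm := isHermitian_iff_isSymm.1 hQ.1
  have hPs : P.IsSymm := isHermitian_iff_isSymm.1 hP.1
  have hQx : 0 ≤ x ⬝ᵥ Q *ᵥ x := by simpa using hQ.dotProduct_mulVec_nonneg x
  have hPe : 0 ≤ e ⬝ᵥ P *ᵥ e := by simpa using hP.dotProduct_mulVec_nonneg e
  rcases hQx.eq_or_lt with h0 | h0
  -- Here `e` has zero `P`-form, so `P e = 0` and `Δ = 0` already suffices.
  · have : F *ᵥ e = 0 := by
      refine mulVec_eq_zero_of_robust hQ h ((hP.dotProduct_mulVec_zero_iff e).1 ?_)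
      rw [star_trivial]; linarith
    have h1 := h 0 (by simpa using hQ) x hx
    simpa [this] using h1
  · set q := x ⬝ᵥ Q *ᵥ x with hq
    -- This rank-one `Δ` satisfies `Δᵀ x = e`, and Cauchy–Schwarz for `Q` gives `Δ P Δᵀ ⪯ Q`.
    set Δ : Matrix ι κ ℝ := vecMulVec (q⁻¹ • Q *ᵥ x) e with hΔ
    have hΔv : ∀ y, Δᵀ *ᵥ y = (q⁻¹ * (y ⬝ᵥ Q *ᵥ x)) • e := by
      intro y
      rw [hΔ, transpose_vecMulVec, vecMulVec_mulVec, smul_dotProduct, dotProduct_comm,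
        op_smul_eq_smul, smul_eq_mul]
    have hΔx : Δᵀ *ᵥ x = e := by
      rw [hΔv, ← hq, inv_mul_cancel₀ h0.ne', one_smul]
    have hmem : (Q - Δ * P * Δᵀ).PosSemidef := by
      rw [IsSymm.posSemidef_iff]
      · intro y
        rw [sub_mulVec, dotProduct_sub, dotProduct_mul_mul_transpose_mulVec, hΔv,
          dotProduct_mulVec_smul_self, mul_pow]
        have hcs := hQ.sq_dotProduct_mulVec_le y x
        rw [← hq] at hcs
        have hle : q⁻¹ ^ 2 * (y ⬝ᵥ Q *ᵥ x) ^ 2 * (e ⬝ᵥ P *ᵥ e) ≤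
            q⁻¹ ^ 2 * (y ⬝ᵥ Q *ᵥ y * q) * q := by
          have := (sq_nonneg _).trans hcs
          gcongr
        have : q⁻¹ ^ 2 * (y ⬝ᵥ Q *ᵥ y * q) * q = y ⬝ᵥ Q *ᵥ y := by field_simp
        linarith
      · refine hQs.sub ?_
        rw [IsSymm, transpose_mul, transpose_mul, transpose_transpose, hPs.eq, Matrix.mul_assoc]
    have := h Δ hmem x hx
    rwa [dotProduct_add_mul_transpose_mulVec, hΔx] at this

/-- A strict implication between the two forms survives a small perturbation of both. -/
lemma exists_pos_perturbation (hQ : Q.PosSemidef) (hP : P.PosSemidef) {H : Matrix ι κ ℝ}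
    (h : ∀ x, x ≠ 0 → ∀ e, e ⬝ᵥ P *ᵥ e ≤ x ⬝ᵥ Q *ᵥ x →
      0 < x ⬝ᵥ E *ᵥ x + 2 * (x ⬝ᵥ (H * P) *ᵥ e)) :
    ∃ ε : ℝ, 0 < ε ∧ ∀ x, x ≠ 0 → ∀ e, e ⬝ᵥ P *ᵥ e ≤ x ⬝ᵥ Q *ᵥ x + ε * (x ⬝ᵥ x) →
      ε * (x ⬝ᵥ x) < x ⬝ᵥ E *ᵥ x + 2 * (x ⬝ᵥ (H * P) *ᵥ e) := by
  have hHP : ∀ x e, x ⬝ᵥ (H * P) *ᵥ e = (Hᵀ *ᵥ x) ⬝ᵥ P *ᵥ e := fun x e => by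
    rw [← mulVec_mulVec, dotProduct_mulVec, ← mulVec_transpose]
  simp only [hHP] at h ⊢
  let S : (ι → ℝ) → ℝ := fun x => (Hᵀ *ᵥ x) ⬝ᵥ P *ᵥ (Hᵀ *ᵥ x)
  have hS : ∀ x, 0 ≤ S x := fun x => hP.dotProduct_mulVec_nonneg (Hᵀ *ᵥ x)
  have hQ0 : ∀ x, 0 ≤ x ⬝ᵥ Q *ᵥ x := fun x => by simpa using hQ.dotProduct_mulVec_nonneg x
  -- For `ε ≥ 0`, the worst case over admissible `e`, by Cauchy–Schwarz for `P`. For negative `ε`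
  -- the convention that `√` vanishes on negative reals keeps `φ` continuous.
  let φ : ℝ → (ι → ℝ) → ℝ := fun ε x =>
    x ⬝ᵥ E *ᵥ x - ε * (x ⬝ᵥ x) - 2 * √((x ⬝ᵥ Q *ᵥ x + ε * (x ⬝ᵥ x)) * S x)
  have hφ : Continuous (Function.uncurry φ) := by
    simp only [φ, S, Function.uncurry_def]
    fun_prop
  have hpos : ∀ x ∈ Metric.sphere (0 : ι → ℝ) 1, 0 < φ 0 x := by
    intro x hx
    have hx0 : x ≠ 0 := by rintro rfl; simp at hx
    simp only [φ, zero_mul, add_zero, sub_zero]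
    rcases (hS x).eq_or_lt with hs | hs
    · have := h x hx0 0 (by simpa using hQ0 x)
      simpa [← hs] using this
    -- The minimising `e`: opposite to `Hᵀ x`, scaled to the boundary of the constraint.
    · have := h x hx0 (-√(x ⬝ᵥ Q *ᵥ x / S x) • (Hᵀ *ᵥ x)) (by
        rw [dotProduct_mulVec_smul_self, neg_sq, Real.sq_sqrt (div_nonneg (hQ0 x) hs.le)]
        exact (div_mul_cancel₀ _ hs.ne').le)
      rw [mulVec_smul, dotProduct_smul, smul_eq_mul] at this
      have e : √(x ⬝ᵥ Q *ᵥ x / S x) * S x = √(x ⬝ᵥ Q *ᵥ x * S x) := by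
        rw [Real.sqrt_div' _ hs.le, Real.sqrt_mul' _ hs.le]
        nth_rw 2 [← Real.mul_self_sqrt hs.le]
        field_simp
      change 0 < _ + 2 * (-_ * S x) at this
      linarith
  have hev : ∀ᶠ ε in nhds (0 : ℝ), ∀ x ∈ Metric.sphere (0 : ι → ℝ) 1, 0 < φ ε x :=
    (isCompact_sphere _ _).eventually_forall_of_forall_eventually fun x hx =>
      hφ.continuousAt.eventually_mem (isOpen_Ioi.mem_nhds (hpos x hx))
  obtain ⟨ε, hε, hε0⟩ :=
    ((hev.filter_mono nhdsWithin_le_nhds).and (self_mem_nhdsWithin (s := Set.Ioi (0 : ℝ)))).exists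
  have hε0 : 0 < ε := hε0
  refine ⟨ε, hε0, fun x hx e he => ?_⟩
  have hnx : 0 < ‖x‖ := norm_pos_iff.2 hx
  have main : ∀ y ∈ Metric.sphere (0 : ι → ℝ) 1, ∀ e,
      e ⬝ᵥ P *ᵥ e ≤ y ⬝ᵥ Q *ᵥ y + ε * (y ⬝ᵥ y) →
      ε * (y ⬝ᵥ y) < y ⬝ᵥ E *ᵥ y + 2 * ((Hᵀ *ᵥ y) ⬝ᵥ P *ᵥ e) := by
    intro y hy e he
    have h1 := hε y hy
    have h2 : |(Hᵀ *ᵥ y) ⬝ᵥ P *ᵥ e| ≤ √((y ⬝ᵥ Q *ᵥ y + ε * (y ⬝ᵥ y)) * S y) := by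
      apply Real.abs_le_sqrt
      refine (hP.sq_dotProduct_mulVec_le _ _).trans ?_
      rw [mul_comm]
      exact mul_le_mul_of_nonneg_right he (hS y)
    have h3 := (abs_le.1 h2).1
    simp only [φ] at h1
    linarith
  -- Both forms are homogeneous of degree two in `(x, e)`, so the sphere suffices.
  have hy : ‖x‖⁻¹ • x ∈ Metric.sphere (0 : ι → ℝ) 1 := by
    simp [norm_smul, hnx.ne']
  have := main _ hy (‖x‖⁻¹ • e) (by
    rw [dotProduct_mulVec_smul_self, dotProduct_mulVec_smul_self]
    simp only [smul_dotProduct, dotProduct_smul, smul_eq_mul]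
    have := mul_le_mul_of_nonneg_left he (sq_nonneg ‖x‖⁻¹)
    linarith)
  rw [dotProduct_mulVec_smul_self] at this
  simp only [mulVec_smul, smul_dotProduct, dotProduct_smul, smul_eq_mul] at this
  have hc : 0 < ‖x‖⁻¹ ^ 2 := by positivity
  refine lt_of_mul_lt_mul_left ?_ hc.le
  linarith

/-- Lossless multiplier for a linear matrix inequality that holds robustly over
`Q - Δ P Δᵀ ⪰ 0`. -/
theorem exists_multiplier_of_robust (hQ : Q.PosSemidef) (hP : P.PosSemidef)
    (h : ∀ Δ : Matrix ι κ ℝ, (Q - Δ * P * Δᵀ).PosSemidef →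
      ∀ x, x ≠ 0 → 0 < x ⬝ᵥ (E + F * Δᵀ + Δ * Fᵀ) *ᵥ x) :
    ∃ α β : ℝ, 0 ≤ α ∧ 0 < β ∧ ∀ x e,
      α * (x ⬝ᵥ Q *ᵥ x - e ⬝ᵥ P *ᵥ e) + β * (x ⬝ᵥ x) ≤ x ⬝ᵥ E *ᵥ x + 2 * (x ⬝ᵥ F *ᵥ e) := by
  classical
  obtain ⟨H, rfl⟩ := exists_eq_mul_of_ker_le P F fun v hv => mulVec_eq_zero_of_robust hQ h hv
  obtain ⟨ε, hε, hlt⟩ := exists_pos_perturbation hQ hP fun x hx e he => pos_of_robust hQ hP h hx he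
  have hself : ∀ x : ι → ℝ, 0 ≤ x ⬝ᵥ x := fun x => by
    simpa using dotProduct_star_self_nonneg x
  by_cases hι : ∃ x : ι → ℝ, x ≠ 0
  · obtain ⟨x₀, hx₀⟩ := hι
    have hM : ∀ x e, (Sum.elim x e) ⬝ᵥ
        fromBlocks (E - ε • 1) (H * P) (H * P)ᵀ 0 *ᵥ Sum.elim x e =
          x ⬝ᵥ E *ᵥ x + 2 * (x ⬝ᵥ (H * P) *ᵥ e) - ε * (x ⬝ᵥ x) := by
      intro x e
      have : e ⬝ᵥ (H * P)ᵀ *ᵥ x = x ⬝ᵥ (H * P) *ᵥ e := by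
        rw [mulVec_transpose, dotProduct_comm, dotProduct_mulVec]
      rw [fromBlocks_mulVec, sumElim_dotProduct_sumElim]
      simp only [Sum.elim_comp_inl, Sum.elim_comp_inr, dotProduct_add, this, sub_mulVec,
        dotProduct_sub, smul_mulVec, one_mulVec, zero_mulVec, dotProduct_zero, dotProduct_smul,
        smul_eq_mul]
      ring
    have hN : ∀ x e, (Sum.elim x e) ⬝ᵥ fromBlocks (Q + ε • 1) 0 0 (-P) *ᵥ Sum.elim x e =
          x ⬝ᵥ Q *ᵥ x + ε * (x ⬝ᵥ x) - e ⬝ᵥ P *ᵥ e := by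
      intro x e
      rw [fromBlocks_mulVec, sumElim_dotProduct_sumElim]
      simp only [Sum.elim_comp_inl, Sum.elim_comp_inr, dotProduct_add, add_mulVec,
        smul_mulVec, one_mulVec, zero_mulVec, dotProduct_zero, dotProduct_smul,
        smul_eq_mul, neg_mulVec, dotProduct_neg]
      ring
    obtain ⟨α, hα, hle⟩ := exists_nonneg_mul_le_of_pos
        (M := fromBlocks (E - ε • 1) (H * P) (H * P)ᵀ 0)
        (N := fromBlocks (Q + ε • 1) 0 0 (-P)) (by
      intro z hz
      obtain ⟨x, e, rfl⟩ : ∃ x e, z = Sum.elim x e :=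
        ⟨z ∘ Sum.inl, z ∘ Sum.inr, (Sum.elim_comp_inl_inr z).symm⟩
      rw [hN] at hz
      rw [hM]
      -- At `x = 0`, nonnegativity of `N` forces `P e = 0`, which puts `(0, e)` in the radical of
      -- `N`: the exceptional case the S-lemma allows.
      by_cases hx : x = 0
      · subst hx
        right
        have hPe : P *ᵥ e = 0 := by
          refine (hP.dotProduct_mulVec_zero_iff e).1 (le_antisymm ?_ (hP.dotProduct_mulVec_nonneg e))
          rw [star_trivial]
          simpa using hz
        refine ⟨by simp, fun w => ?_⟩
        have hw : fromBlocks (Q + ε • 1) 0 0 (-P) *ᵥ Sum.elim (0 : ι → ℝ) e = 0 := by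
          rw [fromBlocks_mulVec]
          ext (i | i) <;> simp [hPe, neg_mulVec]
        have hs : (fromBlocks (Q + ε • 1) 0 0 (-P)).IsSymm := by
          have hQs : Q.IsSymm := isHermitian_iff_isSymm.1 hQ.1
          have hPs : P.IsSymm := isHermitian_iff_isSymm.1 hP.1
          exact (hQs.add (isSymm_one.smul ε)).fromBlocks (by simp) hPs.neg
        rw [mulVec_add, hw, add_zero, add_dotProduct, hs.dotProduct_mulVec_comm (Sum.elim 0 e), hw]
        simp
      · left
        linarith [hlt x hx e (by linarith)])
      ⟨Sum.elim x₀ 0, by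
        rw [hN]
        have h1 : 0 ≤ x₀ ⬝ᵥ Q *ᵥ x₀ := by simpa using hQ.dotProduct_mulVec_nonneg x₀
        have h2 : 0 < x₀ ⬝ᵥ x₀ := by simpa using dotProduct_star_self_pos_iff.2 hx₀
        simp only [zero_dotProduct, sub_zero]
        positivity⟩
    refine ⟨α, ε, hα, hε, fun x e => ?_⟩
    have := hle (Sum.elim x e)
    rw [hM, hN] at this
    nlinarith [mul_nonneg hα (mul_nonneg hε.le (hself x))]
  · push Not at hι
    refine ⟨0, 1, le_rfl, one_pos, fun x e => ?_⟩
    simp [hι x]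

end Robust

end Matrix

open Matrix

/-! ### The strict matrix S-lemma. -/

section MatrixSLemma

variable {ι κ : Type*} [Fintype ι] [Fintype κ] [DecidableEq ι]

lemma qmiValue_fromBlocks (A : Matrix ι ι ℝ) (B : Matrix ι κ ℝ) (D : Matrix κ κ ℝ)
    (Z : Matrix ι κ ℝ) :
    qmiValue (fromBlocks A B Bᵀ D) Z = A + B * Zᵀ + Z * Bᵀ + Z * D * Zᵀ := by
  rw [qmiValue, transpose_fromRows, transpose_one, transpose_transpose, fromCols_mul_fromBlocks,
    fromCols_mul_fromRows]
  simp only [Matrix.one_mul, Matrix.mul_one, Matrix.add_mul]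
  abel

lemma qmiValue_sub_smul (M N : Matrix (ι ⊕ κ) (ι ⊕ κ) ℝ) (α : ℝ) (Z : Matrix ι κ ℝ) :
    qmiValue (M - α • N) Z = qmiValue M Z - α • qmiValue N Z := by
  simp only [qmiValue, Matrix.mul_sub, Matrix.sub_mul, Matrix.mul_smul, Matrix.smul_mul]

/-- The strict matrix S-lemma for a matrix inequality that is affine in the unknown, under
nonemptiness of the hypothesis set only. -/
theorem QBP_subset_SQBP_iff {E : Matrix ι ι ℝ} (hE : E.IsSymm) (F : Matrix ι κ ℝ)
    {N : Matrix (ι ⊕ κ) (ι ⊕ κ) ℝ} (hN : N.IsSymm) (hN22 : (-N.toBlocks₂₂).PosSemidef)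
    (hker : ∀ v, N.toBlocks₂₂ *ᵥ v = 0 → N.toBlocks₁₂ *ᵥ v = 0) (hne : (QBP N).Nonempty) :
    QBP N ⊆ SQBP (fromBlocks E F Fᵀ 0) ↔
      ∃ α β : ℝ, 0 ≤ α ∧ 0 < β ∧ (fromBlocks (E - β • 1) F Fᵀ 0 - α • N).PosSemidef := by
  constructor
  · intro h
    obtain ⟨C, hC⟩ := exists_eq_mul_of_ker_le _ _ hker
    obtain ⟨A, B, D, rfl⟩ : ∃ A B D, N = fromBlocks A B Bᵀ D := by
      refine ⟨N.toBlocks₁₁, N.toBlocks₁₂, N.toBlocks₂₂, ?_⟩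
      have : N.toBlocks₁₂ᵀ = N.toBlocks₂₁ := by
        ext i j
        exact hN.apply _ _
      rw [this, fromBlocks_toBlocks]
    simp only [toBlocks_fromBlocks₂₂, toBlocks_fromBlocks₁₂] at hN22 hC
    obtain ⟨hA, -, -, hD⟩ := isSymm_fromBlocks_iff.1 hN
    obtain ⟨P, rfl⟩ : ∃ P, D = -P := ⟨-D, (neg_neg D).symm⟩
    obtain ⟨Z, rfl⟩ : ∃ Z, C = -Z := ⟨-C, (neg_neg C).symm⟩
    rw [neg_neg] at hN22
    rw [Matrix.neg_mul, Matrix.mul_neg, neg_neg] at hC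
    have hP : Pᵀ = P := by simpa [IsSymm] using hD
    have hBt : Bᵀ = P * Zᵀ := by rw [hC, transpose_mul, hP]
    -- Completing the square: `B = Z P` makes `Z` the centre of the solution set.
    have hval : ∀ Δ, qmiValue (fromBlocks A B Bᵀ (-P)) (Z + Δ) =
        A + Z * P * Zᵀ - Δ * P * Δᵀ := by
      intro Δ
      rw [qmiValue_fromBlocks, hBt, hC]
      simp only [transpose_add, Matrix.add_mul, Matrix.mul_add, Matrix.mul_neg, Matrix.neg_mul,
        Matrix.mul_assoc]
      abel
    have hQ : (A + Z * P * Zᵀ).PosSemidef := by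
      obtain ⟨Z₀, hZ₀⟩ := hne
      have h0 : (qmiValue (fromBlocks A B Bᵀ (-P)) Z₀).PosSemidef := hZ₀
      rw [← add_sub_cancel Z Z₀, hval] at h0
      have := h0.add (hN22.mul_mul_conjTranspose_same (Z₀ - Z))
      rwa [conjTranspose_eq_transpose_of_trivial, sub_add_cancel] at this
    have hrob : ∀ Δ : Matrix ι κ ℝ, (A + Z * P * Zᵀ - Δ * P * Δᵀ).PosSemidef →
        ∀ x, x ≠ 0 → 0 < x ⬝ᵥ (E + F * Zᵀ + Z * Fᵀ + F * Δᵀ + Δ * Fᵀ) *ᵥ x := by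
      intro Δ hΔ x hx
      have hmem : Z + Δ ∈ QBP (fromBlocks A B Bᵀ (-P)) := by
        change (qmiValue _ _).PosSemidef
        rwa [hval]
      have hpd : (qmiValue (fromBlocks E F Fᵀ 0) (Z + Δ)).PosDef := h hmem
      have := hpd.dotProduct_mulVec_pos hx
      rw [star_trivial, qmiValue_fromBlocks] at this
      have e : E + F * Zᵀ + Z * Fᵀ + F * Δᵀ + Δ * Fᵀ =
          E + F * (Z + Δ)ᵀ + (Z + Δ) * Fᵀ + (Z + Δ) * (0 : Matrix κ κ ℝ) * (Z + Δ)ᵀ := by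
        simp only [transpose_add, Matrix.add_mul, Matrix.mul_add, Matrix.mul_zero, Matrix.zero_mul]
        abel
      rwa [e]
    obtain ⟨α, β, hα, hβ, hle⟩ := exists_multiplier_of_robust hQ hN22 hrob
    refine ⟨α, β, hα, hβ, ?_⟩
    have hsymm : (fromBlocks (E - β • 1) F Fᵀ 0 - α • fromBlocks A B Bᵀ (-P)).IsSymm :=
      ((hE.sub (isSymm_one.smul β)).fromBlocks rfl isSymm_zero).sub (hN.smul α)
    rw [hsymm.posSemidef_iff]
    intro z
    obtain ⟨x, y, rfl⟩ : ∃ x y, z = Sum.elim x y :=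
      ⟨z ∘ Sum.inl, z ∘ Sum.inr, (Sum.elim_comp_inl_inr z).symm⟩
    have hform : ∀ (R : Matrix ι ι ℝ) (S : Matrix ι κ ℝ) (T : Matrix κ κ ℝ),
        Sum.elim x y ⬝ᵥ fromBlocks R S Sᵀ T *ᵥ Sum.elim x y =
          x ⬝ᵥ R *ᵥ x + 2 * (x ⬝ᵥ S *ᵥ y) + y ⬝ᵥ T *ᵥ y := by
      intro R S T
      have : y ⬝ᵥ Sᵀ *ᵥ x = x ⬝ᵥ S *ᵥ y := by
        rw [mulVec_transpose, dotProduct_comm, dotProduct_mulVec]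
      rw [fromBlocks_mulVec, sumElim_dotProduct_sumElim]
      simp only [Sum.elim_comp_inl, Sum.elim_comp_inr, dotProduct_add, this]
      ring
    -- The shift `e = y - Zᵀ x` undoes the recentring at `Z`.
    have hxe := hle x (y - Zᵀ *ᵥ x)
    have e1 : (y - Zᵀ *ᵥ x) ⬝ᵥ P *ᵥ (y - Zᵀ *ᵥ x) =
        y ⬝ᵥ P *ᵥ y - 2 * (x ⬝ᵥ B *ᵥ y) + x ⬝ᵥ (Z * P * Zᵀ) *ᵥ x := by
      have hxy : (Zᵀ *ᵥ x) ⬝ᵥ P *ᵥ y = x ⬝ᵥ B *ᵥ y := by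
        rw [hC, ← mulVec_mulVec, dotProduct_mulVec x, ← mulVec_transpose]
      have hPs : P.IsSymm := hP
      rw [dotProduct_mul_mul_transpose_mulVec, mulVec_sub, dotProduct_sub, sub_dotProduct,
        sub_dotProduct, hPs.dotProduct_mulVec_comm y (Zᵀ *ᵥ x), hxy]
      ring
    have e2 : x ⬝ᵥ (E + F * Zᵀ + Z * Fᵀ) *ᵥ x + 2 * (x ⬝ᵥ F *ᵥ (y - Zᵀ *ᵥ x)) =
        x ⬝ᵥ E *ᵥ x + 2 * (x ⬝ᵥ F *ᵥ y) := by
      rw [dotProduct_add_mul_transpose_mulVec, mulVec_sub, dotProduct_sub]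
      ring
    rw [e1, e2, add_mulVec, dotProduct_add] at hxe
    rw [sub_mulVec, dotProduct_sub, smul_mulVec, dotProduct_smul, hform, hform]
    simp only [sub_mulVec, smul_mulVec, one_mulVec, neg_mulVec, zero_mulVec, dotProduct_sub,
      dotProduct_smul, dotProduct_neg, dotProduct_zero, smul_eq_mul]
    linarith
  · rintro ⟨α, β, hα, hβ, h⟩ Z hZ
    have hZ : (qmiValue N Z).PosSemidef := hZ
    have h1 : (qmiValue (fromBlocks (E - β • 1) F Fᵀ 0 - α • N) Z).PosSemidef := by
      have := h.conjTranspose_mul_mul_same (fromRows (1 : Matrix ι ι ℝ) Zᵀ)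
      rwa [conjTranspose_eq_transpose_of_trivial] at this
    -- The term `β I` supplies strictness.
    have h2 := PosDef.posSemidef_add (h1.add (hZ.smul hα)) ((PosDef.one (n := ι) (R := ℝ)).smul hβ)
    change (qmiValue (fromBlocks E F Fᵀ 0) Z).PosDef
    convert h2 using 1
    rw [qmiValue_sub_smul, sub_add_cancel, qmiValue_fromBlocks, qmiValue_fromBlocks]
    abel

end MatrixSLemma

/-! ### The data matrix `Ψ` and the plants it describes. -/

section Data

variable {n m L T : ℕ}

lemma LPVAPlant.toMatrix_surjective :
    Function.Surjective (LPVAPlant.toMatrix : LPVAPlant n m L → _) := fun Z =>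
  ⟨⟨fun ℓ => .of fun i j => Z i (.inl (ℓ, j)), .of fun i k => Z i (.inr k)⟩, by
    ext i (p | k) <;> rfl⟩

lemma LPVData.discrepancy_eq (D : LPVData n m L T) (S : LPVAPlant n m L) :
    D.discrepancy S = D.Xδ + S.toMatrix * fromRows (-khatriRao D.Θ D.X) (-D.U) := by
  ext i t
  rw [LPVAPlant.toMatrix, fromCols_mul_fromRows]
  simp only [LPVData.discrepancy, LPVAPlant.Aat, khatriRao, Matrix.mul_neg, of_apply,
    Matrix.add_apply, Matrix.neg_apply, mul_apply, mulVec, dotProduct, Fintype.sum_prod_type,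
    Matrix.sum_apply, Matrix.smul_apply, smul_eq_mul, Finset.sum_mul]
  rw [Finset.sum_comm, sub_sub, sub_eq_add_neg, neg_add]
  congr! 5
  ring

/-- The discrepancy is affine in the plant, and multiplying `[I; Zᵀ]ᵀ` by `D.factor` produces
exactly `[I; Wᵀ]ᵀ`. -/
lemma LPVData.qmiValue_Psi (D : LPVData n m L T) (Φ : Matrix (Fin n ⊕ Fin T) (Fin n ⊕ Fin T) ℝ)
    (S : LPVAPlant n m L) :
    qmiValue (D.Psi Φ) S.toMatrix = qmiValue Φ (D.discrepancy S) := by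
  have : (fromRows (1 : Matrix (Fin n) (Fin n) ℝ) S.toMatrixᵀ)ᵀ * D.factor =
      (fromRows (1 : Matrix (Fin n) (Fin n) ℝ) (D.discrepancy S)ᵀ)ᵀ := by
    rw [transpose_fromRows, transpose_fromRows, LPVData.factor, fromCols_mul_fromBlocks,
      D.discrepancy_eq]
    simp
  have ht := congrArg Matrix.transpose this
  rw [transpose_mul, transpose_transpose, transpose_transpose] at ht
  rw [qmiValue, qmiValue, ← this, ← ht, LPVData.Psi]
  simp only [Matrix.mul_assoc]

lemma LPVData.Psi_isSymm (D : LPVData n m L T) {Φ : Matrix (Fin n ⊕ Fin T) (Fin n ⊕ Fin T) ℝ}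
    (hΦ : Φ.IsSymm) : (D.Psi Φ).IsSymm := by
  rw [IsSymm, LPVData.Psi, transpose_mul, transpose_mul, transpose_transpose, hΦ.eq,
    Matrix.mul_assoc]

lemma LPVData.Psi_toBlocks (D : LPVData n m L T) (Φ : Matrix (Fin n ⊕ Fin T) (Fin n ⊕ Fin T) ℝ) :
    (D.Psi Φ).toBlocks₂₂ = fromRows (-khatriRao D.Θ D.X) (-D.U) * Φ.toBlocks₂₂ *
        (fromRows (-khatriRao D.Θ D.X) (-D.U))ᵀ ∧
      (D.Psi Φ).toBlocks₁₂ = (Φ.toBlocks₁₂ + D.Xδ * Φ.toBlocks₂₂) *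
        (fromRows (-khatriRao D.Θ D.X) (-D.U))ᵀ := by
  rw [LPVData.Psi, LPVData.factor]
  nth_rw 1 3 [← fromBlocks_toBlocks Φ]
  rw [fromBlocks_transpose, fromBlocks_multiply, fromBlocks_multiply, toBlocks_fromBlocks₂₂,
    toBlocks_fromBlocks₁₂]
  simp

end Data

theorem theorem2 {n m L T Nv : ℕ}
    (D : LPVData n m L T)
    (Φ : Matrix (Fin n ⊕ Fin T) (Fin n ⊕ Fin T) ℝ)
    (hΦ : Φ.IsSymm)
    (hΦ22 : (-Φ.toBlocks₂₂).PosSemidef)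
    (hΦker : LinearMap.ker Φ.toBlocks₂₂.mulVecLin ≤ LinearMap.ker Φ.toBlocks₁₂.mulVecLin)
    (truth : LPVAPlant n m L)
    (htruth : D.discrepancy truth ∈ QBP Φ)
    (ω : Fin Nv → Fin L → ℝ)
    (Y : Matrix (Fin n) (Fin n) ℝ) (hY : Y.PosDef)
    (K : Fin Nv → Matrix (Fin m) (Fin n) ℝ)
    (v : Fin Nv) :
    (∀ S ∈ consistentPlants D Φ, S.toMatrix ∈ SQBP (vertexMatrix Y (ω v) (K v) 0)) ↔
      ∃ α β : ℝ, 0 ≤ α ∧ 0 < β ∧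
        (vertexMatrix Y (ω v) (K v) β - α • D.Psi Φ).PosSemidef := by
  have hmem : ∀ S : LPVAPlant n m L, S.toMatrix ∈ QBP (D.Psi Φ) ↔ S ∈ consistentPlants D Φ :=
    fun S => by
      change (qmiValue _ _).PosSemidef ↔ (qmiValue _ _).PosSemidef
      rw [D.qmiValue_Psi]
  obtain ⟨h22, h12⟩ := D.Psi_toBlocks Φ
  set R := fromRows (-khatriRao D.Θ D.X) (-D.U)
  have hP22 : (-(D.Psi Φ).toBlocks₂₂).PosSemidef := by
    have := hΦ22.mul_mul_conjTranspose_same R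
    rwa [conjTranspose_eq_transpose_of_trivial, Matrix.mul_neg, Matrix.neg_mul, ← h22] at this
  have hker : ∀ x, (D.Psi Φ).toBlocks₂₂ *ᵥ x = 0 → (D.Psi Φ).toBlocks₁₂ *ᵥ x = 0 := by
    intro x hx
    -- The semidefinite form `-Φ₂₂` vanishes at `Rᵀ x`, so `Rᵀ x` lies in its kernel; the kernel
    -- inclusion thus passes from `Φ` to `Ψ`.
    have h0 : Φ.toBlocks₂₂ *ᵥ (Rᵀ *ᵥ x) = 0 := by
      have := (hΦ22.dotProduct_mulVec_zero_iff (Rᵀ *ᵥ x)).1 (by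
        rw [star_trivial, neg_mulVec, dotProduct_neg, ← dotProduct_mul_mul_transpose_mulVec, ← h22,
          hx, dotProduct_zero, neg_zero])
      rwa [neg_mulVec, neg_eq_zero] at this
    have h1 : Φ.toBlocks₁₂ *ᵥ (Rᵀ *ᵥ x) = 0 := hΦker h0
    rw [h12, ← mulVec_mulVec, add_mulVec, ← mulVec_mulVec, h0, h1, mulVec_zero, add_zero]
  have hvertex : ∀ β, vertexMatrix Y (ω v) (K v) β = fromBlocks (0 - β • 1)
      (fromRows (-vecKron (ω v) Y⁻¹) (-(K v * Y⁻¹)))ᵀ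
      (fromRows (-vecKron (ω v) Y⁻¹) (-(K v * Y⁻¹)))ᵀᵀ 0 := fun β => by
    rw [vertexMatrix, zero_sub, transpose_transpose]
  simp only [hvertex]
  rw [← QBP_subset_SQBP_iff isSymm_zero _ (D.Psi_isSymm hΦ) hP22 hker
    ⟨_, (hmem truth).2 htruth⟩, zero_smul, sub_zero]
  refine ⟨fun h Z hZ => ?_, fun h S hS => h ((hmem S).2 hS)⟩
  obtain ⟨S, rfl⟩ := LPVAPlant.toMatrix_surjective Z
  exact h S ((hmem S).1 hZ)
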